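/- Let $\mathfrak R=\mathbb{Z}_4+v\mathbb{Z}_4=\mathbb{Z}_4[v]/\langle v^2-v\rangle$. A linear code of length $n$ over $\mathfrak R$ is an $\mathfrak R$-submodule $C\subseteq\mathfrak R^n$. It is cyclic if $(c_{n-1},c_0,\dots,c_{n-2})\in C$ for every $(c_0,c_1,\dots,c_{n-1})\in C$. Let $C^{\perp}=\{h\in\mathfrak R^n : \sum_{i=0}^{n-1}h_ik_i=0 \text{ for all } k\in C\}$, let $\mathrm{Hull}(C)=C\cap C^{\perp}$, and define the $2$-dimension of a code $D$ by $\dim_2(D)=\log_2|D|$. Let $\mathcal C(n)$ be the (finite) set of all cyclic codes of length $n$ over $\mathfrak R$, and let $$E(n)=\frac{1}{|\mathcal C(n)|}\sum_{C\in\mathcal C(n)}\dim_2(\mathrm{Hull}(C))$$ be the average $2$-dimension of the hull of a cyclic code of length $n$ over $\mathfrak R$ chosen uniformly at random. Let $N_2=\{l\ge 1 : l \text{ divides } 2^i+1 \text{ for some positive integer } i\}$ and $B_n=\sum_{j\mid n,\ j\in N_2}\phi(j)$, where $j$ runs over the positive divisors of $n$ and $\phi$ is Euler's totient function. Then for every odd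 positive integer $n$, $$E(n)=\frac{10n}{9}-\frac{4B_n}{9}.$$ -/

import Mathlib

/-- The ring `ℤ₄ + vℤ₄ = ℤ₄[v]/⟨v² - v⟩`: elements `a + b v` with `a b : ℤ₄` and `v² = 0 + 1·v`. -/
abbrev Z4v : Type := QuadraticAlgebra (ZMod 4) 0 1

instance Z4v.instFinite : Finite Z4v :=
  Finite.of_equiv _ (QuadraticAlgebra.equivProd (0 : ZMod 4) 1).symm

/-- The cyclic shift `(c₀, c₁, …, cₙ₋₁) ↦ (cₙ₋₁, c₀, …, cₙ₋₂)`. -/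
def cyclicShift {R : Type*} {n : ℕ} (c : Fin n → R) : Fin n → R :=
  fun i => c ((finRotate n).symm i)

/-- A linear code of length `n` over `R` is an `R`-submodule of `Rⁿ`; it is cyclic if it is
closed under the cyclic shift. -/
def IsCyclicCode {R : Type*} [CommRing R] {n : ℕ} (C : Submodule R (Fin n → R)) : Prop :=
  ∀ c ∈ C, cyclicShift c ∈ C

/-- The dual code with respect to the inner product `h · k = ∑ i, hᵢ kᵢ`. -/
def dualCode {R : Type*} [CommRing R] {n : ℕ} (C : Submodule R (Fin n → R)) :
    Submodule R (Fin n → R) where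
  carrier := {h | ∀ k ∈ C, ∑ i, h i * k i = 0}
  zero_mem' := by
    intro k _
    simp
  add_mem' := by
    intro a b ha hb k hk
    simp only [Set.mem_ofPred_eq] at ha hb
    simp [add_mul, Finset.sum_add_distrib, ha k hk, hb k hk]
  smul_mem' := by
    intro r a ha k hk
    simp only [Set.mem_ofPred_eq] at ha
    simp [mul_assoc, ← Finset.mul_sum, ha k hk]

/-- The hull `C ∩ C^⊥` of a code. -/
def hull {R : Type*} [CommRing R] {n : ℕ} (C : Submodule R (Fin n → R)) :
    Submodule R (Fin n → R) :=
  C ⊓ dualCode C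

/-- The `2`-dimension `log₂ |C|` of a code. -/
noncomputable def twoDim {R : Type*} [CommRing R] {n : ℕ} (C : Submodule R (Fin n → R)) : ℝ :=
  Real.logb 2 (Nat.card C)

/-- The cyclic codes of length `n` over `R`. -/
abbrev CyclicCode (R : Type*) [CommRing R] (n : ℕ) : Type _ :=
  {C : Submodule R (Fin n → R) // IsCyclicCode C}

noncomputable instance CyclicCode.instFintype (R : Type*) [CommRing R] [Finite R] (n : ℕ) :
    Fintype (CyclicCode R n) :=
  Fintype.ofFinite _

/-- The average `2`-dimension of the hull of a uniformly chosen cyclic code of length `n`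
over `R`. -/
noncomputable def averageHullTwoDim (R : Type*) [CommRing R] [Finite R] (n : ℕ) : ℝ :=
  (∑ C : CyclicCode R n, twoDim (hull C.1)) / (Fintype.card (CyclicCode R n) : ℝ)

/-- `N₂`: the `l ≥ 1` dividing `2 ^ i + 1` for some positive integer `i`. -/
def N2 : Set ℕ := {l | 1 ≤ l ∧ ∃ i : ℕ, 0 < i ∧ l ∣ 2 ^ i + 1}

open Classical in
/-- `Bₙ`: the sum of `φ(j)` over the divisors `j` of `n` that lie in `N₂`. -/
noncomputable def B (n : ℕ) : ℕ := ∑ j ∈ n.divisors with j ∈ N2, Nat.totient j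

/-! Cyclic codes are the ideals of `A = Z4v[x]/(x^n - 1)`, written as a group ring. Let `K` be a
finite field of characteristic 2 containing a primitive `n`-th root of unity. The `n` roots together
with the two reductions of `Z4v` to `𝔽₂` give `2n` places `A → K`, and Frobenius permutes the places
by doubling exponents. `EvaluationFrame` records what is used of this situation.

An ideal `I` is determined by two Frobenius-stable sets of places, the supports `res I ⊆ tor I` of
`I` and of `(I : 2)`, and every such pair occurs. Equivalently, each Frobenius orbit carries an
independent level 0, 1 or 2 (`level_bijective`), and `log₂ |I| = |res I| + |tor I|` (`card_ideal`).
With `τ` the inversion of roots, duality turns level `l` at `τ t` into level `2 - l` at `t`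
(`mem_res_dualIdeal`, `mem_tor_dualIdeal`), and intersecting ideals intersects both supports.

For a uniform ideal, a place `t` therefore contributes `1/9 + 4/9 = 5/9` to the mean of the hull if
`t` and `τ t` lie in different orbits, and `0 + 1/3` if they share one (`sum_level_pairs`). The
second case occurs at `2 B n` places (`card_sameCycle_neg`), so the mean is `2n · 5/9 - 2 B n ·
2/9`. -/

/-- A commutative ring `A` with `4 = 0` in which `2A` is the annihilator of `2`, together with a
finite family of homomorphisms to a field `K` of characteristic two that jointly detect
divisibility by `2`, are permuted by the Frobenius map, and separate Frobenius-stable sets. -/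
structure EvaluationFrame (A K T : Type*) [CommRing A] [Field K] [Fintype T] where
  ev : T → A →+* K
  frob : Equiv.Perm T
  ev_frob : ∀ t x, ev (frob t) x = ev t x ^ 2
  two_eq_zero : (2 : K) = 0
  four_eq_zero : (4 : A) = 0
  dvd_of_ev : ∀ x, (∀ t, ev t x = 0) → 2 ∣ x
  dvd_of_two_mul : ∀ x : A, 2 * x = 0 → 2 ∣ x
  exists_indicator : ∀ S : Set T, (∀ t, frob t ∈ S ↔ t ∈ S) →
    ∃ e, (∀ t ∈ S, ev t e = 1) ∧ ∀ t ∉ S, ev t e = 0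
  coord : T → A →+ ZMod 2
  exists_coord : ∀ S : Finset T, ∃ J : Finset T, J.card = S.card ∧
    ∀ x, (∀ t ∉ S, ev t x = 0) → (∀ j ∈ J, coord j x = 0) → ∀ t, ev t x = 0
  card_eq : Nat.card A = 4 ^ Fintype.card T

/-! ### Supports of ideals, classification of ideals, and duality. -/

namespace EvaluationFrame

variable {A K T : Type*} [CommRing A] [Field K] [Fintype T] (E : EvaluationFrame A K T)

open Classical in
/-- The places at which some element of the ideal does not vanish. -/
noncomputable def res (I : Ideal A) : Finset T := {t | ∃ x ∈ I, E.ev t x ≠ 0}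

/-- The ideal `(I : 2)`. -/
def half (I : Ideal A) : Ideal A where
  carrier := {x | 2 * x ∈ I}
  add_mem' {a b} ha hb := by
    change 2 * (a + b) ∈ I
    rw [mul_add]
    exact I.add_mem ha hb
  zero_mem' := by simp
  smul_mem' c x hx := by
    change 2 * (c * x) ∈ I
    rw [mul_left_comm]
    exact I.mul_mem_left c hx

/-- The residue support of `(I : 2)`. -/
noncomputable def tor (I : Ideal A) : Finset T := E.res (half I)

lemma mem_half {I : Ideal A} {x : A} : x ∈ half I ↔ 2 * x ∈ I := Iff.rfl

lemma mem_res {I : Ideal A} {t : T} : t ∈ E.res I ↔ ∃ x ∈ I, E.ev t x ≠ 0 := by simp [res]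

lemma mem_tor {I : Ideal A} {t : T} : t ∈ E.tor I ↔ ∃ x, 2 * x ∈ I ∧ E.ev t x ≠ 0 := by
  simp [tor, mem_res, mem_half]

lemma ev_eq_zero {I : Ideal A} {t : T} (ht : t ∉ E.res I) {x : A} (hx : x ∈ I) :
    E.ev t x = 0 := by
  by_contra h
  exact ht (E.mem_res.2 ⟨x, hx, h⟩)

lemma le_half (I : Ideal A) : I ≤ half I := fun _ hx => I.mul_mem_left 2 hx

lemma res_subset_tor (I : Ideal A) : E.res I ⊆ E.tor I := by
  intro t ht
  obtain ⟨x, hx, h⟩ := E.mem_res.1 ht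
  exact E.mem_res.2 ⟨x, le_half I hx, h⟩

lemma two_mem_half (E : EvaluationFrame A K T) (I : Ideal A) : (2 : A) ∈ half I := by
  rw [mem_half, show (2 * 2 : A) = 4 by norm_num, E.four_eq_zero]
  exact I.zero_mem

lemma ev_two (t : T) : E.ev t 2 = 0 := by rw [map_ofNat, E.two_eq_zero]

/-- Both sides say that `x ∈ 2A`. This turns identities multiplied by 2 into identities in `K`. -/
lemma two_mul_eq_zero_iff (x : A) : 2 * x = 0 ↔ ∀ t, E.ev t x = 0 := by
  constructor
  · intro h t
    obtain ⟨y, rfl⟩ := E.dvd_of_two_mul x h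
    rw [map_mul, E.ev_two, zero_mul]
  · intro h
    obtain ⟨y, rfl⟩ := E.dvd_of_ev x h
    rw [← mul_assoc, show (2 * 2 : A) = 4 by norm_num, E.four_eq_zero, zero_mul]

lemma res_frob (I : Ideal A) (t : T) : E.frob t ∈ E.res I ↔ t ∈ E.res I := by
  simp [mem_res, E.ev_frob]

lemma tor_frob (I : Ideal A) (t : T) : E.frob t ∈ E.tor I ↔ t ∈ E.tor I := E.res_frob _ t

/-- An ideal contains an element whose evaluations are the indicator of its residue support. -/
lemma exists_mem_indicator [Finite K] (I : Ideal A) :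
    ∃ u ∈ I, (∀ t ∈ E.res I, E.ev t u = 1) ∧ ∀ t ∉ E.res I, E.ev t u = 0 := by
  classical
  have := Fintype.ofFinite K
  choose! x hx using fun t (ht : t ∈ E.res I) => E.mem_res.1 ht
  have hq : Fintype.card K - 1 ≠ 0 := by
    have := Fintype.one_lt_card (α := K)
    omega
  -- In a field with `q` elements, `a ^ (q - 1)` is 1 unless `a = 0`. So the factor at `t` vanishes
  -- at `t`, while every factor is 1 modulo `I`.
  set p : A := ∏ t ∈ E.res I, (1 - x t ^ (Fintype.card K - 1)) with hp
  have hu : 1 - p ∈ I := by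
    rw [← Ideal.Quotient.eq_zero_iff_mem, map_sub, hp, map_prod, map_one]
    rw [Finset.prod_eq_one, sub_self]
    intro t ht
    rw [map_sub, map_pow, Ideal.Quotient.eq_zero_iff_mem.2 (hx t ht).1, zero_pow hq, map_one,
      sub_zero]
  refine ⟨1 - p, hu, fun t ht => ?_, fun t ht => E.ev_eq_zero ht hu⟩
  rw [hp, map_sub, map_prod, map_one, Finset.prod_eq_zero ht, sub_zero]
  rw [map_sub, map_pow, FiniteField.pow_card_sub_one_eq_one _ (hx t ht).2, map_one, sub_self]

/-- Elements with equal evaluations have equal squares. -/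
lemma sq_eq_sq {x y : A} (h : ∀ t, E.ev t x = E.ev t y) : x ^ 2 = y ^ 2 := by
  obtain ⟨z, hz⟩ := E.dvd_of_ev (x - y) fun t => by rw [map_sub, h, sub_self]
  obtain rfl : x = y + 2 * z := by rw [← hz]; ring
  linear_combination (y * z + z ^ 2) * E.four_eq_zero

/-- Squaring depends only on the class modulo 2, so it lifts idempotents of `A/2A` to `A`. -/
lemma sq_isIdempotent {x : A} (h : ∀ t, E.ev t x = 0 ∨ E.ev t x = 1) :
    x ^ 2 * x ^ 2 = x ^ 2 := by
  rw [← pow_two]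
  refine E.sq_eq_sq fun t => ?_
  rcases h t with h | h <;> simp [h]

/-- The elements all of whose evaluations outside `S` vanish. -/
def supported (S : Finset T) : Ideal A where
  carrier := {x | ∀ t ∉ S, E.ev t x = 0}
  add_mem' ha hb t ht := by rw [map_add, ha t ht, hb t ht, add_zero]
  zero_mem' t _ := map_zero _
  smul_mem' c x hx t ht := by rw [smul_eq_mul, map_mul, hx t ht, mul_zero]

lemma mem_supported {S : Finset T} {x : A} :
    x ∈ E.supported S ↔ ∀ t ∉ S, E.ev t x = 0 := Iff.rfl

lemma eq_supported [Finite K] {J : Ideal A} (h2 : (2 : A) ∈ J) :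
    J = E.supported (E.res J) := by
  refine le_antisymm (fun x hx t ht => E.ev_eq_zero ht hx) fun x hx => ?_
  obtain ⟨u, hu, hu1, hu0⟩ := E.exists_mem_indicator J
  obtain ⟨z, hz⟩ := E.dvd_of_ev (x * (1 - u)) fun t => by
    by_cases ht : t ∈ E.res J
    · simp [hu1 t ht]
    · simp [hx t ht]
  have : x = x * u + 2 * z := by rw [← hz]; ring
  rw [this]
  exact J.add_mem (J.mul_mem_left _ hu) (J.mul_mem_right _ h2)

lemma half_eq_supported [Finite K] (I : Ideal A) : half I = E.supported (E.tor I) :=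
  E.eq_supported (E.two_mem_half I)

/-- Split `x ∈ I` as `x u² + 2z` with `u ∈ I` an indicator. The first term is in `J` because `u² =
(uw)²` for an indicator `w ∈ J`. The second is, because `z ∈ (I : 2)` and an ideal containing 2 is
determined by its support. -/
lemma le_of_subset [Finite K] {I J : Ideal A} (h1 : E.res I ⊆ E.res J)
    (h2 : E.tor I ⊆ E.tor J) : I ≤ J := by
  obtain ⟨u, hu, hu1, hu0⟩ := E.exists_mem_indicator I
  obtain ⟨w, hw, hw1, hw0⟩ := E.exists_mem_indicator J
  have huw : u ^ 2 = (u * w) ^ 2 := E.sq_eq_sq fun t => by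
    by_cases ht : t ∈ E.res I
    · simp [hu1 t ht, hw1 t (h1 ht)]
    · simp [hu0 t ht]
  have huJ : u ^ 2 ∈ J := by
    rw [huw, show (u * w) ^ 2 = u ^ 2 * w * w by ring]
    exact J.mul_mem_left _ hw
  intro x hx
  have hv : ∀ t, E.ev t (x * (1 - u ^ 2)) = 0 := fun t => by
    by_cases ht : t ∈ E.res I
    · simp [hu1 t ht]
    · simp [E.ev_eq_zero ht hx]
  obtain ⟨z, hz⟩ := E.dvd_of_ev _ hv
  have hzI : z ∈ half I := by
    rw [mem_half, ← hz]
    exact I.mul_mem_right _ hx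
  have hzJ : z ∈ half J := by
    rw [E.half_eq_supported] at hzI ⊢
    exact fun t ht => hzI t fun h => ht (h2 h)
  have : x = x * u ^ 2 + 2 * z := by rw [← hz]; ring
  rw [this]
  exact J.add_mem (J.mul_mem_left _ huJ) hzJ

lemma eq_of_res_tor [Finite K] {I J : Ideal A} (h1 : E.res I = E.res J)
    (h2 : E.tor I = E.tor J) : I = J :=
  le_antisymm (E.le_of_subset h1.subset h2.subset) (E.le_of_subset h1.superset h2.superset)

lemma exists_ideal {S₁ S₂ : Finset T} (h : S₁ ⊆ S₂) (h1 : ∀ t, E.frob t ∈ S₁ ↔ t ∈ S₁)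
    (h2 : ∀ t, E.frob t ∈ S₂ ↔ t ∈ S₂) : ∃ I : Ideal A, E.res I = S₁ ∧ E.tor I = S₂ := by
  obtain ⟨a, ha1, ha0⟩ := E.exists_indicator S₁ h1
  obtain ⟨b, hb1, hb0⟩ := E.exists_indicator S₂ h2
  have hidem : a ^ 2 * a ^ 2 = a ^ 2 := E.sq_isIdempotent fun t => by
    by_cases ht : t ∈ S₁
    · exact Or.inr (ha1 t ht)
    · exact Or.inl (ha0 t ht)
  refine ⟨Ideal.span {a ^ 2, 2 * b}, ?_, ?_⟩
  · ext t
    rw [mem_res]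
    constructor
    · rintro ⟨x, hx, hne⟩
      by_contra ht
      obtain ⟨c, d, rfl⟩ := Ideal.mem_span_pair.1 hx
      exact hne (by simp [ha0 t ht, E.ev_two])
    · exact fun ht => ⟨a ^ 2, Ideal.subset_span (by simp), by simp [ha1 t ht]⟩
  · ext t
    rw [mem_tor]
    constructor
    · rintro ⟨x, hx, hne⟩
      by_contra ht
      have ht1 : t ∉ S₁ := fun h' => ht (h h')
      obtain ⟨c, d, hcd⟩ := Ideal.mem_span_pair.1 hx
      -- Multiplying by the complementary idempotent `1 - a²` removes the generator `a²`.
      have hz : 2 * ((x - d * b) * (1 - a ^ 2)) = 0 := by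
        linear_combination (-(1 - a ^ 2)) * hcd + (-c) * hidem
      have := (E.two_mul_eq_zero_iff _).1 hz t
      simp only [map_mul, map_sub, map_one, map_pow, ha0 t ht1, hb0 t ht] at this
      exact hne (by simpa using this)
    · exact fun ht => ⟨b, Ideal.subset_span (by simp), by simp [hb1 t ht]⟩

lemma res_inf (I J : Ideal A) [DecidableEq T] : E.res (I ⊓ J) = E.res I ∩ E.res J := by
  ext t
  simp only [Finset.mem_inter, mem_res]
  constructor
  · rintro ⟨x, hx, h⟩
    exact ⟨⟨x, hx.1, h⟩, ⟨x, hx.2, h⟩⟩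
  · rintro ⟨⟨x, hx, h⟩, ⟨y, hy, h'⟩⟩
    exact ⟨x * y, ⟨I.mul_mem_right _ hx, J.mul_mem_left _ hy⟩, by
      rw [map_mul]; exact mul_ne_zero h h'⟩

lemma tor_inf (I J : Ideal A) [DecidableEq T] : E.tor (I ⊓ J) = E.tor I ∩ E.tor J := by
  rw [tor, tor, tor, ← res_inf]
  rfl

/-- The ideal of the elements `h` with `h * σ k = 0` for all `k ∈ I`. -/
def dualIdeal (σ : A →+* A) (I : Ideal A) : Ideal A where
  carrier := {h | ∀ k ∈ I, h * σ k = 0}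
  add_mem' ha hb k hk := by rw [add_mul, ha k hk, hb k hk, add_zero]
  zero_mem' k _ := zero_mul _
  smul_mem' c x hx k hk := by rw [smul_eq_mul, mul_assoc, hx k hk, mul_zero]

variable (σ : A →+* A) (τ : T → T)

/-- If both supports were hit, `x * σ (2 * y) = 0` would give a vanishing product of nonzero values
in `K`. Conversely, for an indicator `w` of `(I : 2)`, each factor `1 - w` pushes `I` one step down:
first into `2A`, then to 0. Hence the square in the witness. -/
lemma mem_res_dualIdeal [Finite K] (hσ : ∀ t x, E.ev t (σ x) = E.ev (τ t) x) (I : Ideal A) (t : T) :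
    t ∈ E.res (dualIdeal σ I) ↔ τ t ∉ E.tor I := by
  constructor
  · intro h h'
    obtain ⟨x, hx, hne⟩ := E.mem_res.1 h
    obtain ⟨y, hy, hne'⟩ := E.mem_tor.1 h'
    have h0 := hx _ hy
    rw [map_mul, map_ofNat, mul_left_comm] at h0
    have := (E.two_mul_eq_zero_iff _).1 h0 t
    rw [map_mul, hσ] at this
    exact mul_ne_zero hne hne' this
  · intro ht
    obtain ⟨w, hw, hw1, hw0⟩ := E.exists_mem_indicator (half I)
    have key : ∀ y ∈ I, (1 - w) ^ 2 * y = 0 := by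
      intro y hy
      obtain ⟨z, hz⟩ := E.dvd_of_ev ((1 - w) * y) fun t => by
        by_cases ht : t ∈ E.tor I
        · simp [hw1 t ht]
        · simp [E.ev_eq_zero ht (le_half I hy)]
      have hzI : z ∈ half I := by
        rw [mem_half, ← hz]
        exact I.mul_mem_left _ hy
      have : 2 * ((1 - w) * z) = 0 := (E.two_mul_eq_zero_iff _).2 fun t => by
        by_cases ht : t ∈ E.tor I
        · simp [hw1 t ht]
        · simp [E.ev_eq_zero ht hzI]
      linear_combination (1 - w) * hz + this
    refine E.mem_res.2 ⟨σ ((1 - w) ^ 2), fun k hk => ?_, ?_⟩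
    · rw [← map_mul, key k hk, map_zero]
    · rw [hσ]
      simp [hw0 _ ht]

/-- The factor 2 is already present here, so a single `1 - u` suffices in the witness. -/
lemma mem_tor_dualIdeal [Finite K] (hσ : ∀ t x, E.ev t (σ x) = E.ev (τ t) x) (I : Ideal A) (t : T) :
    t ∈ E.tor (dualIdeal σ I) ↔ τ t ∉ E.res I := by
  constructor
  · intro h h'
    obtain ⟨x, hx, hne⟩ := E.mem_tor.1 h
    obtain ⟨y, hy, hne'⟩ := E.mem_res.1 h'
    have h0 := hx _ hy
    rw [mul_assoc] at h0
    have := (E.two_mul_eq_zero_iff _).1 h0 t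
    rw [map_mul, hσ] at this
    exact mul_ne_zero hne hne' this
  · intro ht
    obtain ⟨u, hu, hu1, hu0⟩ := E.exists_mem_indicator I
    refine E.mem_tor.2 ⟨σ (1 - u), fun k hk => ?_, ?_⟩
    · rw [mul_assoc, ← map_mul]
      refine (E.two_mul_eq_zero_iff _).2 fun t => ?_
      rw [hσ]
      by_cases ht : τ t ∈ E.res I
      · simp [hu1 _ ht]
      · simp [E.ev_eq_zero ht hk]
    · rw [hσ]
      simp [hu0 _ ht]

end EvaluationFrame

/-! ### Cardinalities of ideals. -/

lemma AddMonoidHom.card_ker_mul_card_range {G H : Type*} [AddGroup G] [AddGroup H] (f : G →+ H) :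
    Nat.card f.ker * Nat.card f.range = Nat.card G := by
  rw [← AddSubgroup.index_ker, AddSubgroup.card_mul_index]

lemma Submodule.card_sup_mul_card_inf {R M : Type*} [Ring R] [AddCommGroup M] [Module R M]
    (p q : Submodule R M) :
    Nat.card ↥(p ⊔ q) * Nat.card ↥(p ⊓ q) = Nat.card p * Nat.card q := by
  have h1 := Submodule.card_eq_card_quotient_mul_card (Submodule.comap p.subtype (p ⊓ q))
  have h2 := Submodule.card_eq_card_quotient_mul_card (Submodule.comap (p ⊔ q).subtype q)
  have h3 := Nat.card_congr (LinearMap.quotientInfEquivSupQuotient p q).toEquiv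
  have h4 := Nat.card_congr (Submodule.comapSubtypeEquivOfLe (inf_le_left : p ⊓ q ≤ p)).toEquiv
  have h5 := Nat.card_congr (Submodule.comapSubtypeEquivOfLe (le_sup_right : q ≤ p ⊔ q)).toEquiv
  rw [h4, Submodule.comap_inf] at h1
  rw [h5, ← h3] at h2
  rw [h1, h2]
  ring

namespace EvaluationFrame

variable {A K T : Type*} [CommRing A] [Field K] [Fintype T] (E : EvaluationFrame A K T)

/-- Multiplication by 2 has kernel and image both equal to `2A`, so `|2A|² = |A|`. -/
lemma card_supported_empty : Nat.card (E.supported ∅) = 2 ^ Fintype.card T := by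
  let f : A →+ A := AddMonoidHom.mulLeft 2
  have hk : Nat.card f.ker = Nat.card (E.supported ∅) :=
    Nat.card_congr (Equiv.subtypeEquivRight fun x => by
      rw [AddMonoidHom.mem_ker, mem_supported]
      simpa [f] using E.two_mul_eq_zero_iff x)
  have hr : Nat.card f.range = Nat.card (E.supported ∅) :=
    Nat.card_congr (Equiv.subtypeEquivRight fun x => by
      rw [AddMonoidHom.mem_range, mem_supported]
      constructor
      · rintro ⟨y, rfl⟩ t -
        simp [f, E.ev_two]
      · intro h
        obtain ⟨y, hy⟩ := E.dvd_of_ev x fun t => h t (Finset.notMem_empty t)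
        exact ⟨y, hy.symm⟩)
  have h := f.card_ker_mul_card_range
  rw [hk, hr, E.card_eq, ← pow_two, show 4 = 2 ^ 2 by norm_num, pow_right_comm] at h
  exact Nat.pow_left_injective two_ne_zero h

lemma card_supported_le [Finite A] (S : Finset T) :
    Nat.card (E.supported S) ≤ 2 ^ Fintype.card T * 2 ^ S.card := by
  obtain ⟨J, hJ, h⟩ := E.exists_coord S
  let f : E.supported S →+ (J → ZMod 2) :=
    { toFun x j := E.coord j x
      map_zero' := by ext; simp
      map_add' x y := by ext; simp }
  rw [← f.card_ker_mul_card_range, ← E.card_supported_empty]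
  refine Nat.mul_le_mul ?_ ?_
  · refine Nat.card_le_card_of_injective
      (fun x => (⟨x.1.1, fun t _ => h x.1.1 x.1.2 (fun j hj => ?_) t⟩ : E.supported ∅)) ?_
    · exact congrFun ((AddMonoidHom.mem_ker).1 x.2) ⟨j, hj⟩
    · intro x y hxy
      exact Subtype.ext (Subtype.ext (congrArg (fun z : E.supported ∅ => z.1) hxy))
  · have hle : Nat.card f.range ≤ Nat.card (J → ZMod 2) :=
      Nat.card_le_card_of_injective _ Subtype.val_injective
    rwa [Nat.card_fun, Nat.card_zmod, Nat.card_eq_fintype_card (α := J), Fintype.card_coe, hJ] at hle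

/-- The upper bounds for `S` and `Sᶜ` multiply to `|A| * |2A|`. That is also the product of the two
cardinalities, since the two ideals have sum `A` and intersection `2A`. Both bounds are therefore
attained. -/
lemma card_supported [Finite A] (S : Finset T) (hS : ∀ t, E.frob t ∈ S ↔ t ∈ S) :
    Nat.card (E.supported S) = 2 ^ Fintype.card T * 2 ^ S.card := by
  classical
  have hsup : E.supported S ⊔ E.supported Sᶜ = ⊤ := by
    obtain ⟨e, he1, he0⟩ := E.exists_indicator S hS
    rw [Ideal.eq_top_iff_one, show (1 : A) = e + (1 - e) by ring]
    refine Submodule.add_mem_sup he0 fun t ht => ?_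
    rw [Finset.mem_compl, not_not] at ht
    simp [he1 t ht]
  have hinf : E.supported S ⊓ E.supported Sᶜ = E.supported ∅ := by
    ext x
    simp only [Submodule.mem_inf, mem_supported, Finset.mem_compl, not_not, Finset.notMem_empty,
      not_false_eq_true, forall_true_left]
    exact ⟨fun h t => (em (t ∈ S)).elim (h.2 t) (h.1 t), fun h => ⟨fun t _ => h t, fun t _ => h t⟩⟩
  have h := Submodule.card_sup_mul_card_inf (E.supported S) (E.supported Sᶜ)
  rw [hsup, hinf, E.card_supported_empty, Nat.card_congr Submodule.topEquiv.toEquiv, E.card_eq] at h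
  refine le_antisymm (E.card_supported_le S) ?_
  have hc := E.card_supported_le Sᶜ
  have hTS := S.card_add_card_compl
  by_contra! hlt
  have hlt' := Nat.mul_lt_mul_of_lt_of_le hlt hc (by positivity)
  rw [← h, ← hTS, show 4 = 2 ^ 2 by norm_num] at hlt'
  refine hlt'.ne ?_
  simp only [← pow_mul, ← pow_add]
  congr 1
  ring

/-- Here `I + 2A` consists of all elements supported on `res I`, while `I ∩ 2A = 2 (I : 2)` has `2 ^
|tor I|` elements. -/
lemma card_ideal [Finite A] [Finite K] (I : Ideal A) :
    Nat.card I = 2 ^ ((E.res I).card + (E.tor I).card) := by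
  have hsup : I ⊔ E.supported ∅ = E.supported (E.res I) := by
    refine le_antisymm (sup_le (fun x hx t ht => E.ev_eq_zero ht hx)
      fun x hx t _ => hx t (Finset.notMem_empty t)) fun x hx => ?_
    obtain ⟨u, hu, hu1, hu0⟩ := E.exists_mem_indicator I
    rw [show x = x * u + x * (1 - u) by ring]
    refine Submodule.add_mem_sup (I.mul_mem_left _ hu) fun t _ => ?_
    by_cases ht : t ∈ E.res I
    · simp [hu1 t ht]
    · simp [hx t ht]
  let f : half I →+ A := (AddMonoidHom.mulLeft 2).comp (half I).toAddSubgroup.subtype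
  have hf : ∀ x : half I, f x = 2 * x.1 := fun _ => rfl
  have hk : Nat.card f.ker = Nat.card (E.supported ∅) := by
    refine Nat.card_congr ⟨fun x => ⟨x.1.1, fun t _ => ?_⟩, fun x => ⟨⟨x.1, ?_⟩, ?_⟩,
      fun _ => rfl, fun _ => rfl⟩
    · exact (E.two_mul_eq_zero_iff _).1 ((AddMonoidHom.mem_ker).1 x.2) t
    · rw [mem_half, (E.two_mul_eq_zero_iff _).2 fun t => x.2 t (Finset.notMem_empty t)]
      exact I.zero_mem
    · exact (E.two_mul_eq_zero_iff _).2 fun t => x.2 t (Finset.notMem_empty t)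
  have hr : Nat.card f.range = Nat.card ↥(I ⊓ E.supported ∅) :=
    Nat.card_congr (Equiv.subtypeEquivRight fun x => by
      rw [AddMonoidHom.mem_range, Submodule.mem_inf, mem_supported]
      constructor
      · rintro ⟨y, rfl⟩
        exact ⟨y.2, fun t _ => by rw [hf, map_mul, E.ev_two, zero_mul]⟩
      · rintro ⟨hx, h⟩
        obtain ⟨y, rfl⟩ := E.dvd_of_ev x fun t => h t (Finset.notMem_empty t)
        exact ⟨⟨y, hx⟩, rfl⟩)
  have h1 := f.card_ker_mul_card_range
  rw [hk, hr, E.half_eq_supported, E.card_supported _ (E.tor_frob I)] at h1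
  have h2 := Submodule.card_sup_mul_card_inf I (E.supported ∅)
  rw [hsup, E.card_supported _ (E.res_frob I)] at h2
  rw [E.card_supported_empty] at h1 h2
  have h3 := Nat.eq_of_mul_eq_mul_left (by positivity) h1
  rw [h3, mul_assoc, mul_comm (Nat.card I)] at h2
  rw [← Nat.eq_of_mul_eq_mul_left (by positivity) h2, pow_add]

end EvaluationFrame

/-! ### Ideals as three-valued functions on Frobenius orbits. -/

namespace EvaluationFrame

variable {A K T : Type*} [CommRing A] [Field K] [Fintype T] (E : EvaluationFrame A K T)

/-- The orbits of the Frobenius permutation. -/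
abbrev Orbit : Type _ := Quotient (Equiv.Perm.SameCycle.setoid E.frob)

/-- The orbit of a place. -/
abbrev orbit (t : T) : E.Orbit := Quotient.mk _ t

lemma orbit_frob (t : T) : E.orbit (E.frob t) = E.orbit t :=
  Quotient.sound (Equiv.Perm.sameCycle_apply_left.2 (Equiv.Perm.SameCycle.refl _ _))

lemma mem_iff_of_sameCycle {S : Finset T} (hS : ∀ t, E.frob t ∈ S ↔ t ∈ S) {s t : T}
    (h : E.frob.SameCycle s t) : s ∈ S ↔ t ∈ S := by
  obtain ⟨k, rfl⟩ := h.exists_nat_pow_eq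
  induction k with
  | zero => rfl
  | succ k ih =>
    rw [pow_succ', Equiv.Perm.mul_apply, hS]
    exact ih ⟨k, rfl⟩

open Classical in
/-- The local exponent of an ideal at each orbit: `0`, `1` or `2`. -/
noncomputable def level (I : Ideal A) : E.Orbit → Fin 3 :=
  Quotient.lift (fun t => if t ∈ E.res I then 2 else if t ∈ E.tor I then 1 else 0)
    fun s t h => by
      simp only [E.mem_iff_of_sameCycle (E.res_frob I) h, E.mem_iff_of_sameCycle (E.tor_frob I) h]

lemma mem_res_iff_level (I : Ideal A) (t : T) : t ∈ E.res I ↔ E.level I (E.orbit t) = 2 := by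
  simp only [level, Quotient.lift_mk]
  split_ifs <;> simp_all

lemma mem_tor_iff_level (I : Ideal A) (t : T) : t ∈ E.tor I ↔ E.level I (E.orbit t) ≠ 0 := by
  have := @E.res_subset_tor _ _ _ _ _ _ I t
  simp only [level, Quotient.lift_mk]
  split_ifs <;> simp_all

lemma level_bijective [Finite K] : Function.Bijective E.level := by
  classical
  constructor
  · intro I J h
    refine E.eq_of_res_tor ?_ ?_ <;> ext t
    · rw [mem_res_iff_level, mem_res_iff_level, h]
    · rw [mem_tor_iff_level, mem_tor_iff_level, h]
  · intro f
    obtain ⟨I, h1, h2⟩ := E.exists_ideal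
      (S₁ := {t | f (E.orbit t) = 2}) (S₂ := {t | f (E.orbit t) ≠ 0})
      (fun t => by simp +contextual) (fun t => by simp [E.orbit_frob])
      (fun t => by simp [E.orbit_frob])
    refine ⟨I, funext fun q => ?_⟩
    induction q using Quotient.inductionOn with | _ t =>
    have h3 := E.mem_res_iff_level I t
    have h4 := E.mem_tor_iff_level I t
    rw [h1] at h3
    rw [h2] at h4
    simp only [Finset.mem_filter_univ] at h3 h4
    revert h3 h4
    change (f (E.orbit t) = 2 ↔ E.level I (E.orbit t) = 2) →
      (f (E.orbit t) ≠ 0 ↔ E.level I (E.orbit t) ≠ 0) → E.level I (E.orbit t) = f (E.orbit t)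
    generalize E.level I (E.orbit t) = a
    generalize f (E.orbit t) = b
    revert a b
    decide

end EvaluationFrame

/-! ### Averaging over three-valued functions. -/

/-- The number of functions `Q → Fin 3` with prescribed ranges at two distinct points. -/
lemma card_filter_two_points {Q : Type*} [Fintype Q] [DecidableEq Q] {q q' : Q} (h : q ≠ q')
    (U V : Finset (Fin 3)) :
    9 * (Finset.univ.filter fun f : Q → Fin 3 => f q ∈ U ∧ f q' ∈ V).card =
      U.card * V.card * Fintype.card (Q → Fin 3) := by
  have hset : (Finset.univ.filter fun f : Q → Fin 3 => f q ∈ U ∧ f q' ∈ V) =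
      Fintype.piFinset fun x => if x = q then U else if x = q' then V else Finset.univ := by
    ext f
    simp only [Finset.mem_filter_univ, Fintype.mem_piFinset]
    constructor
    · rintro ⟨h1, h2⟩ x
      split_ifs with hx hx'
      · exact hx ▸ h1
      · exact hx' ▸ h2
      · exact Finset.mem_univ _
    · intro hf
      have h1 := hf q
      have h2 := hf q'
      rw [if_pos rfl] at h1
      rw [if_neg h.symm, if_pos rfl] at h2
      exact ⟨h1, h2⟩
  have hq' : q' ∈ Finset.univ.erase q := Finset.mem_erase.2 ⟨h.symm, Finset.mem_univ _⟩
  rw [hset, Fintype.card_piFinset, Fintype.card_pi, ← Finset.mul_prod_erase _ _ (Finset.mem_univ q),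
    ← Finset.mul_prod_erase _ _ hq', ← Finset.mul_prod_erase _ _ (Finset.mem_univ q),
    ← Finset.mul_prod_erase _ _ hq', if_pos rfl, if_neg h.symm, if_pos rfl]
  rw [Finset.prod_congr rfl fun x hx => ?_]
  · simp only [Fintype.card_fin]
    ring
  · simp only [Finset.mem_erase] at hx
    rw [if_neg hx.2.1, if_neg hx.1, Finset.card_univ, Fintype.card_fin]

/-- The number of functions `Q → Fin 3` with prescribed range at one point. -/
lemma card_filter_one_point {Q : Type*} [Fintype Q] [DecidableEq Q] (q : Q)
    (U : Finset (Fin 3)) :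
    3 * (Finset.univ.filter fun f : Q → Fin 3 => f q ∈ U).card =
      U.card * Fintype.card (Q → Fin 3) := by
  have hset : (Finset.univ.filter fun f : Q → Fin 3 => f q ∈ U) =
      Fintype.piFinset fun x => if x = q then U else Finset.univ := by
    ext f
    simp only [Finset.mem_filter_univ, Fintype.mem_piFinset]
    constructor
    · intro h1 x
      split_ifs with hx
      · exact hx ▸ h1
      · exact Finset.mem_univ _
    · intro hf
      simpa using hf q
  rw [hset, Fintype.card_piFinset, Fintype.card_pi, ← Finset.mul_prod_erase _ _ (Finset.mem_univ q),
    ← Finset.mul_prod_erase _ _ (Finset.mem_univ q), if_pos rfl]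
  rw [Finset.prod_congr rfl fun x hx => ?_]
  · simp only [Fintype.card_fin]
    ring
  · rw [if_neg (Finset.ne_of_mem_erase hx), Finset.card_univ, Fintype.card_fin]

lemma sum_level_pairs {Q : Type*} [Fintype Q] [DecidableEq Q] (q q' : Q) :
    ∑ f : Q → Fin 3, ((if f q = 2 ∧ f q' = 0 then 1 else 0) +
      (if f q ≠ 0 ∧ f q' ≠ 2 then 1 else 0) : ℝ) =
    (5 / 9 - if q = q' then 2 / 9 else 0) * Fintype.card (Q → Fin 3) := by
  rw [Finset.sum_add_distrib, Finset.sum_boole, Finset.sum_boole]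
  split_ifs with h
  · subst h
    have h1 : (Finset.univ.filter fun f : Q → Fin 3 => f q = 2 ∧ f q = 0) = ∅ := by
      refine Finset.filter_eq_empty_iff.2 fun f _ hf => ?_
      exact absurd (hf.1.symm.trans hf.2) (by decide)
    have h2 := card_filter_one_point q {1}
    have h3 : (Finset.univ.filter fun f : Q → Fin 3 => f q ≠ 0 ∧ f q ≠ 2) =
        Finset.univ.filter fun f : Q → Fin 3 => f q ∈ ({1} : Finset (Fin 3)) := by
      refine Finset.filter_congr fun f _ => ?_
      generalize f q = a
      revert a
      decide
    rw [h1, h3]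
    have h2' := congrArg (Nat.cast : ℕ → ℝ) h2
    push_cast [Finset.card_singleton, Finset.card_empty] at h2' ⊢
    linarith
  · have h1 := congrArg (Nat.cast : ℕ → ℝ) (card_filter_two_points h {2} {0})
    have h2 := congrArg (Nat.cast : ℕ → ℝ) (card_filter_two_points h {1, 2} {0, 1})
    have h3 : (Finset.univ.filter fun f : Q → Fin 3 => f q = 2 ∧ f q' = 0) =
        Finset.univ.filter fun f : Q → Fin 3 =>
          f q ∈ ({2} : Finset (Fin 3)) ∧ f q' ∈ ({0} : Finset (Fin 3)) :=
      Finset.filter_congr fun f _ => by simp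
    have h4 : (Finset.univ.filter fun f : Q → Fin 3 => f q ≠ 0 ∧ f q' ≠ 2) =
        Finset.univ.filter fun f : Q → Fin 3 =>
          f q ∈ ({1, 2} : Finset (Fin 3)) ∧ f q' ∈ ({0, 1} : Finset (Fin 3)) := by
      refine Finset.filter_congr fun f _ => ?_
      generalize f q = a
      generalize f q' = b
      revert a b
      decide
    have h5 : ({1, 2} : Finset (Fin 3)).card = 2 := rfl
    have h6 : ({0, 1} : Finset (Fin 3)).card = 2 := rfl
    rw [h3, h4]
    rw [h5, h6] at h2
    push_cast [Finset.card_singleton] at h1 h2 ⊢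
    linarith

namespace EvaluationFrame

variable {A K T : Type*} [CommRing A] [Field K] [Fintype T] (E : EvaluationFrame A K T)

open Classical in
/-- The sum of `log₂ |I ∩ I^⊥|` over all ideals. -/
lemma sum_logb_card_inf_dualIdeal [Finite A] [Finite K] [Fintype (Ideal A)] (σ : A →+* A)
    (τ : T → T) (hσ : ∀ t x, E.ev t (σ x) = E.ev (τ t) x) :
    ∑ I : Ideal A, Real.logb 2 (Nat.card ↥(I ⊓ dualIdeal σ I)) =
      (5 / 9 * Fintype.card T - 2 / 9 * (Finset.univ.filter fun t =>
        E.frob.SameCycle t (τ t)).card) * Fintype.card (Ideal A) := by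
  -- The first indicator detects `t` in the residue support of the hull, the second in its torsion
  -- support.
  have hI : ∀ I : Ideal A, Real.logb 2 (Nat.card ↥(I ⊓ dualIdeal σ I)) =
      ∑ t, ((if E.level I (E.orbit t) = 2 ∧ E.level I (E.orbit (τ t)) = 0 then 1 else 0) +
      (if E.level I (E.orbit t) ≠ 0 ∧ E.level I (E.orbit (τ t)) ≠ 2 then 1 else 0) : ℝ) := by
    intro I
    rw [E.card_ideal, Nat.cast_pow, Nat.cast_ofNat, Real.logb_pow, Real.logb_self_eq_one one_lt_two,
      mul_one, Finset.sum_add_distrib, Finset.sum_boole, Finset.sum_boole, Nat.cast_add]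
    congr 3
    · ext t
      rw [E.res_inf, Finset.mem_inter, E.mem_res_dualIdeal σ τ hσ, Finset.mem_filter_univ,
        mem_res_iff_level, mem_tor_iff_level, not_not]
    · ext t
      rw [E.tor_inf, Finset.mem_inter, E.mem_tor_dualIdeal σ τ hσ, Finset.mem_filter_univ,
        mem_res_iff_level, mem_tor_iff_level]
  let L := Equiv.ofBijective E.level E.level_bijective
  simp_rw [hI]
  rw [Finset.sum_comm, Fintype.card_congr L]
  have ht : ∀ t, ∑ I : Ideal A,
      ((if E.level I (E.orbit t) = 2 ∧ E.level I (E.orbit (τ t)) = 0 then 1 else 0) +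
      (if E.level I (E.orbit t) ≠ 0 ∧ E.level I (E.orbit (τ t)) ≠ 2 then 1 else 0) : ℝ) =
      (5 / 9 - if E.orbit t = E.orbit (τ t) then 2 / 9 else 0) *
        Fintype.card (E.Orbit → Fin 3) := by
    intro t
    rw [← sum_level_pairs]
    exact Equiv.sum_comp L fun f : E.Orbit → Fin 3 =>
      ((if f (E.orbit t) = 2 ∧ f (E.orbit (τ t)) = 0 then 1 else 0) +
      (if f (E.orbit t) ≠ 0 ∧ f (E.orbit (τ t)) ≠ 2 then 1 else 0) : ℝ)
  rw [Finset.sum_congr rfl fun t _ => ht t, ← Finset.sum_mul, Finset.sum_sub_distrib,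
    Finset.sum_const, ← Finset.sum_filter, Finset.sum_const]
  have hfix : (Finset.univ.filter fun t => E.orbit t = E.orbit (τ t)) =
      Finset.univ.filter fun t => E.frob.SameCycle t (τ t) :=
    Finset.filter_congr fun t _ => Quotient.eq
  rw [hfix, Finset.card_univ, nsmul_eq_mul, nsmul_eq_mul]
  ring

end EvaluationFrame

/-! ### The coefficient ring. -/

/-- The two reductions `ℤ₄ + vℤ₄ → 𝔽₂`, sending `v` to `ε`. -/
def Z4v.reduction (ε : ZMod 2) : Z4v →+* ZMod 2 where
  toFun r := ZMod.castHom (by norm_num : 2 ∣ 4) (ZMod 2) r.re +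
    ε * ZMod.castHom (by norm_num : 2 ∣ 4) (ZMod 2) r.im
  map_one' := by
    rw [show (1 : Z4v).re = 1 from rfl, show (1 : Z4v).im = 0 from rfl]
    simp
  map_zero' := by simp
  map_add' x y := by
    rw [QuadraticAlgebra.re_add, QuadraticAlgebra.im_add, map_add, map_add]
    ring
  map_mul' x y := by
    have hε : ε * ε = ε := by revert ε; decide
    rw [QuadraticAlgebra.re_mul, QuadraticAlgebra.im_mul]
    simp only [map_add, map_mul, map_zero, map_one]
    linear_combination (-(ZMod.castHom (by norm_num : 2 ∣ 4) (ZMod 2) x.im *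
      ZMod.castHom (by norm_num : 2 ∣ 4) (ZMod 2) y.im)) * hε

namespace Z4v

lemma exists_two_mul_of_reduction (r : Z4v) (h : ∀ ε, reduction ε r = 0) : ∃ s, r = 2 * s := by
  obtain ⟨a, b⟩ := r
  have key : ∀ a b : ZMod 4, (∀ ε, ZMod.castHom (by norm_num : 2 ∣ 4) (ZMod 2) a +
      ε * ZMod.castHom (by norm_num : 2 ∣ 4) (ZMod 2) b = 0) →
      ∃ c d : ZMod 4, a = c + c ∧ b = d + d := by decide
  obtain ⟨c, d, rfl, rfl⟩ := key a b h
  exact ⟨⟨c, d⟩, by rw [two_mul]; rfl⟩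

lemma exists_two_mul_of_add_self (r : Z4v) (h : r + r = 0) : ∃ s, r = s + s := by
  obtain ⟨a, b⟩ := r
  have key : ∀ a b : ZMod 4, a + a = 0 → b + b = 0 →
      ∃ c d : ZMod 4, a = c + c ∧ b = d + d := by decide
  obtain ⟨c, d, rfl, rfl⟩ := key a b (congrArg QuadraticAlgebra.re h)
    (congrArg QuadraticAlgebra.im h)
  exact ⟨⟨c, d⟩, rfl⟩

lemma exists_reduction_eq (f : ZMod 2 → ZMod 2) : ∃ r : Z4v, ∀ ε, reduction ε r = f ε := by
  have key : ∀ x y : ZMod 2, ∃ a b : ZMod 4,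
      ZMod.castHom (by norm_num : 2 ∣ 4) (ZMod 2) a +
        0 * ZMod.castHom (by norm_num : 2 ∣ 4) (ZMod 2) b = x ∧
      ZMod.castHom (by norm_num : 2 ∣ 4) (ZMod 2) a +
        1 * ZMod.castHom (by norm_num : 2 ∣ 4) (ZMod 2) b = y := by decide
  obtain ⟨a, b, h0, h1⟩ := key (f 0) (f 1)
  refine ⟨⟨a, b⟩, fun ε => ?_⟩
  fin_cases ε
  · exact h0
  · exact h1

lemma card_eq : Nat.card Z4v = 16 := by
  rw [Nat.card_congr (QuadraticAlgebra.equivProd (0 : ZMod 4) 1), Nat.card_prod, Nat.card_zmod]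

lemma four_eq_zero : (4 : Z4v) = 0 := rfl

end Z4v

/-! ### Vanishing of sequences from their Fourier transform. -/

section Fourier

variable {n : ℕ} [NeZero n] {K : Type*} [Field K] {ψ : AddChar (ZMod n) K}

lemma AddChar.IsPrimitive.injective_zmod (hψ : ψ.IsPrimitive) : Function.Injective ψ := by
  intro a b h
  rw [← sub_eq_zero, ← hψ.zmod_char_eq_one_iff, AddChar.map_sub_eq_div, h, div_self]
  exact fun h0 => by simpa [h0] using (AddChar.map_add_eq_mul ψ b (-b)).symm

/-- A sequence whose Fourier transform vanishes off `S` and whose last `|S|` terms vanish is zero. -/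
lemma eq_zero_of_fourier_eq_zero (hψ : ψ.IsPrimitive) (c : ZMod n → K) (S : Finset (ZMod n))
    (h : ∀ i ∉ S, ∑ k, c k * ψ (i * k) = 0) (hc : ∀ k, n - S.card ≤ k.val → c k = 0) : c = 0 := by
  classical
  -- The degree of `p` is below `|Sᶜ|`, yet `p` vanishes at the `|Sᶜ|` distinct points `ψ i`, `i ∉
  -- S`.
  set p : Polynomial K := ∑ k, Polynomial.C (c k) * Polynomial.X ^ k.val with hp
  have hcard : Sᶜ.card = n - S.card := by rw [Finset.card_compl, ZMod.card]
  have hdeg : p.degree < Sᶜ.card := by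
    rw [← Polynomial.mem_degreeLT]
    refine Submodule.sum_mem _ fun k _ => ?_
    rw [Polynomial.mem_degreeLT]
    rcases le_or_gt (n - S.card) k.val with hk | hk
    · rw [hc k hk, map_zero, zero_mul, Polynomial.degree_zero]
      exact WithBot.bot_lt_coe _
    · refine (Polynomial.degree_C_mul_X_pow_le _ _).trans_lt ?_
      rw [hcard]
      exact_mod_cast hk
  have hp0 : p = 0 := by
    refine Polynomial.eq_zero_of_degree_lt_of_eval_index_eq_zero (v := ψ) _ hψ.injective_zmod.injOn hdeg
      fun i hi => ?_
    rw [hp, Polynomial.eval_finsetSum, ← h i (Finset.mem_compl.1 hi)]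
    refine Finset.sum_congr rfl fun k _ => ?_
    rw [Polynomial.eval_mul, Polynomial.eval_C, Polynomial.eval_pow, Polynomial.eval_X,
      ← AddChar.map_nsmul_eq_pow, nsmul_eq_mul, ZMod.natCast_zmod_val, mul_comm k]
  funext k
  have := congrArg (fun q => Polynomial.coeff q k.val) hp0
  simp only [hp, Polynomial.finsetSum_coeff, Polynomial.coeff_C_mul_X_pow,
    Polynomial.coeff_zero] at this
  rw [Finset.sum_eq_single k] at this
  · simpa using this
  · intro b _ hb
    exact if_neg fun hkb => hb (ZMod.val_injective n hkb.symm)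
  · simp

lemma card_filter_le_val (m : ℕ) :
    (Finset.univ.filter fun k : ZMod n => m ≤ k.val).card = n - m := by
  rw [← Nat.card_Ico, ← Finset.card_map ⟨_, ZMod.val_injective n⟩]
  congr 1
  ext x
  simp only [Finset.mem_map, Finset.mem_filter_univ, Function.Embedding.coeFn_mk, Finset.mem_Ico]
  constructor
  · rintro ⟨k, hk, rfl⟩
    exact ⟨hk, k.val_lt⟩
  · rintro ⟨h1, h2⟩
    exact ⟨x, by rwa [ZMod.val_cast_of_lt h2], ZMod.val_cast_of_lt h2⟩

end Fourier

/-! ### The group ring and its places. -/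

section GroupRing

variable (n : ℕ) [NeZero n]

/-- The ambient ring `(ℤ₄ + vℤ₄)[x]/⟨xⁿ - 1⟩` of cyclic codes, as a group ring. -/
abbrev CyclicRing : Type := AddMonoidAlgebra Z4v (ZMod n)

/-- An element of the group ring is a function on the group. -/
noncomputable def CyclicRing.coeffEquiv : CyclicRing n ≃ (ZMod n → Z4v) :=
  AddMonoidAlgebra.coeffEquiv.trans Finsupp.equivFunOnFinite

instance : Finite (CyclicRing n) := Finite.of_equiv _ (CyclicRing.coeffEquiv n).symm

variable {n}

lemma CyclicRing.exists_coeff_eq (f : ZMod n → Z4v) : ∃ x : CyclicRing n, ∀ k, x.coeff k = f k :=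
  ⟨(CyclicRing.coeffEquiv n).symm f, fun _ => rfl⟩

variable {K : Type*} [Field K] [CharP K 2]

/-- The homomorphism of the group ring to `K` given by a character of the group and a reduction of
the coefficients. -/
noncomputable def CyclicRing.evalHom (ψ : AddChar (ZMod n) K) (t : ZMod n × ZMod 2) :
    CyclicRing n →+* K :=
  AddMonoidAlgebra.liftNCRingHom ((ZMod.castHom (dvd_refl 2) K).comp (Z4v.reduction t.2))
    (AddChar.mulShift ψ t.1).toMonoidHom fun _ _ => Commute.all _ _

lemma CyclicRing.evalHom_apply (ψ : AddChar (ZMod n) K) (t : ZMod n × ZMod 2)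
    (x : CyclicRing n) : CyclicRing.evalHom ψ t x =
      ∑ k, ZMod.castHom (dvd_refl 2) K (Z4v.reduction t.2 (x.coeff k)) * ψ (t.1 * k) := by
  induction x using AddMonoidAlgebra.induction_linear with
  | zero => simp
  | add x y hx hy => simp [hx, hy, add_mul, Finset.sum_add_distrib]
  | single m r =>
    rw [Finset.sum_eq_single m]
    · rw [evalHom, AddMonoidAlgebra.liftNCRingHom_single]
      simp [AddChar.mulShift_apply]
    · intro k _ hk
      simp [Finsupp.single_eq_of_ne hk]
    · simp

end GroupRing

namespace CyclicRing

variable {n : ℕ}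

lemma four_eq_zero : (4 : CyclicRing n) = 0 := by
  have h := map_ofNat (AddMonoidAlgebra.singleZeroRingHom : Z4v →+* CyclicRing n) 4
  rw [← h, show (OfNat.ofNat 4 : Z4v) = 0 from Z4v.four_eq_zero, map_zero]

/-- The `2`-cyclotomic permutation of the places. -/
def frobPerm (hn : Odd n) : Equiv.Perm (ZMod n × ZMod 2) :=
  Equiv.prodCongr (Units.mulLeft (ZMod.unitOfCoprime 2 (Nat.coprime_two_left.2 hn)))
    (Equiv.refl _)

lemma frobPerm_apply (hn : Odd n) (t : ZMod n × ZMod 2) :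
    frobPerm hn t = (2 * t.1, t.2) := by
  simp [frobPerm, Prod.map]

/-- The involution `x ↦ x⁻¹` of the group ring. -/
noncomputable def conj : CyclicRing n →+* CyclicRing n :=
  AddMonoidAlgebra.mapDomainRingHom Z4v (negAddMonoidHom : ZMod n →+ ZMod n)

lemma coeff_conj (x : CyclicRing n) (k : ZMod n) : (conj x).coeff k = x.coeff (-k) := by
  induction x using AddMonoidAlgebra.induction_linear with
  | zero => simp
  | add x y hx hy => simp [hx, hy]
  | single m r =>
    simp [conj, Finsupp.single_apply, neg_eq_iff_eq_neg]

end CyclicRing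

/-! ### The group ring as an evaluation frame. -/

section Frame

variable {n : ℕ} [NeZero n] {K : Type*} [Field K] [CharP K 2] {ψ : AddChar (ZMod n) K}

namespace CyclicRing

lemma reduction_eq_zero_of_evalHom (hψ : ψ.IsPrimitive) (S : Finset (ZMod n × ZMod 2))
    (ε : ZMod 2) (x : CyclicRing n) (h : ∀ t ∉ S, evalHom ψ t x = 0)
    (hx : ∀ k : ZMod n, n - (Finset.univ.filter fun i => (i, ε) ∈ S).card ≤ k.val →
      Z4v.reduction ε (x.coeff k) = 0) (k : ZMod n) : Z4v.reduction ε (x.coeff k) = 0 := by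
  have := eq_zero_of_fourier_eq_zero hψ
    (fun k => ZMod.castHom (dvd_refl 2) K (Z4v.reduction ε (x.coeff k)))
    (Finset.univ.filter fun i => (i, ε) ∈ S)
    (fun i hi => by
      rw [← h (i, ε) (by simpa using hi), evalHom_apply])
    (fun k hk => by rw [hx k hk, map_zero])
  exact (ZMod.castHom (dvd_refl 2) K).injective ((congrFun this k).trans (map_zero _).symm)

lemma evalHom_eq_zero {t : ZMod n × ZMod 2} {x : CyclicRing n}
    (h : ∀ k, Z4v.reduction t.2 (x.coeff k) = 0) : evalHom ψ t x = 0 := by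
  rw [evalHom_apply]
  exact Finset.sum_eq_zero fun k _ => by rw [h, map_zero, zero_mul]

lemma two_dvd_of_evalHom (hψ : ψ.IsPrimitive) (x : CyclicRing n)
    (h : ∀ t, evalHom ψ t x = 0) : 2 ∣ x := by
  -- With `S = ∅` the coefficient condition concerns `n ≤ k.val` and is void.
  have hred : ∀ k ε, Z4v.reduction ε (x.coeff k) = 0 := fun k ε =>
    reduction_eq_zero_of_evalHom hψ ∅ ε x (fun t _ => h t)
      (fun k hk => absurd k.val_lt (by simpa using hk)) k
  choose s hs using fun k => Z4v.exists_two_mul_of_reduction _ (hred k)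
  obtain ⟨y, hy⟩ := exists_coeff_eq s
  refine ⟨y, AddMonoidAlgebra.ext (Finsupp.ext fun k => ?_)⟩
  rw [two_mul, AddMonoidAlgebra.coeff_add, Finsupp.add_apply, hy, hs, two_mul]

lemma two_dvd_of_two_mul (x : CyclicRing n) (h : 2 * x = 0) : 2 ∣ x := by
  have hred : ∀ k, ∃ s, x.coeff k = s + s := fun k =>
    Z4v.exists_two_mul_of_add_self _ (by
      rw [two_mul] at h
      exact DFunLike.congr_fun (congrArg AddMonoidAlgebra.coeff h) k)
  choose s hs using hred
  obtain ⟨y, hy⟩ := exists_coeff_eq s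
  refine ⟨y, AddMonoidAlgebra.ext (Finsupp.ext fun k => ?_)⟩
  rw [two_mul, AddMonoidAlgebra.coeff_add, Finsupp.add_apply, hy, hs]

lemma card_eq : Nat.card (CyclicRing n) = 4 ^ Fintype.card (ZMod n × ZMod 2) := by
  rw [Nat.card_congr (coeffEquiv n), Nat.card_fun, Z4v.card_eq, Fintype.card_prod, ZMod.card,
    ZMod.card, Nat.card_zmod, mul_comm, pow_mul]
  norm_num

lemma evalHom_frobPerm (hn : Odd n) (t : ZMod n × ZMod 2) (x : CyclicRing n) :
    evalHom ψ (frobPerm hn t) x = evalHom ψ t x ^ 2 := by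
  have hsq : ∀ a : ZMod 2, a ^ 2 = a := by decide
  rw [evalHom_apply, evalHom_apply, sum_pow_char 2, frobPerm_apply]
  refine Finset.sum_congr rfl fun k _ => ?_
  rw [mul_pow, ← map_pow, hsq, ← AddChar.map_nsmul_eq_pow, nsmul_eq_mul, mul_assoc, Nat.cast_ofNat]

/-- The coefficients are lifts of the inverse Fourier transform of the indicator of `S`. Squaring
only permutes its summands, by stability of `S` under doubling, so its values lie in `𝔽₂`. No factor
`1/n` is needed, as `n = 1` in `K`. -/
lemma exists_indicator (hn : Odd n) (hψ : ψ.IsPrimitive) (S : Set (ZMod n × ZMod 2))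
    (hS : ∀ t, frobPerm hn t ∈ S ↔ t ∈ S) : ∃ e : CyclicRing n,
    (∀ t ∈ S, evalHom ψ t e = 1) ∧ ∀ t ∉ S, evalHom ψ t e = 0 := by
  classical
  have hfix : ∀ (k : ZMod n) (ε : ZMod 2), ∃ a : ZMod 2, ZMod.castHom (dvd_refl 2) K a =
      ∑ i, if (i, ε) ∈ S then ψ (-(i * k)) else 0 := by
    intro k ε
    set y : K := ∑ i, if (i, ε) ∈ S then ψ (-(i * k)) else 0 with hy
    have hyy : y ^ 2 = y := by
      rw [hy, sum_pow_char 2]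
      refine Fintype.sum_equiv
        (Units.mulLeft (ZMod.unitOfCoprime 2 (Nat.coprime_two_left.2 hn))) _ _ fun i => ?_
      have h2 := hS (i, ε)
      rw [frobPerm_apply] at h2
      simp only [Units.mulLeft_apply, ZMod.coe_unitOfCoprime, Nat.cast_ofNat, h2]
      split_ifs
      · rw [← AddChar.map_nsmul_eq_pow, nsmul_eq_mul, Nat.cast_ofNat]
        congr 1
        ring
      · simp
    have : y * (y - 1) = 0 := by linear_combination hyy
    rcases mul_eq_zero.1 this with h | h
    · exact ⟨0, by rw [map_zero, h]⟩
    · exact ⟨1, by rw [map_one, sub_eq_zero.1 h]⟩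
  choose a ha using hfix
  choose r hr using fun k => Z4v.exists_reduction_eq (a k)
  obtain ⟨e, he⟩ := exists_coeff_eq r
  have hev : ∀ t, evalHom ψ t e = if t ∈ S then 1 else 0 := by
    rintro ⟨j, ε⟩
    have hn1 : (n : K) = 1 := by
      obtain ⟨m, rfl⟩ := hn
      have : (2 : K) = 0 := by exact_mod_cast CharP.cast_eq_zero K 2
      push_cast
      rw [this, zero_mul, zero_add]
    calc evalHom ψ (j, ε) e
        = ∑ k, ∑ i, if (i, ε) ∈ S then ψ (k * (j - i)) else 0 := by
          rw [evalHom_apply]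
          refine Finset.sum_congr rfl fun k _ => ?_
          rw [he, hr, ha, Finset.sum_mul]
          refine Finset.sum_congr rfl fun i _ => ?_
          split_ifs
          · rw [← AddChar.map_add_eq_mul]
            congr 1
            ring
          · rw [zero_mul]
      _ = ∑ i, if (i, ε) ∈ S then (if j - i = 0 then (n : K) else 0) else 0 := by
          rw [Finset.sum_comm]
          refine Finset.sum_congr rfl fun i _ => ?_
          split_ifs with h1 h2
          · rw [AddChar.sum_mulShift _ hψ, if_pos h2, ZMod.card]
          · rw [AddChar.sum_mulShift _ hψ, if_neg h2, Nat.cast_zero]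
          · rw [Finset.sum_const_zero]
      _ = if (j, ε) ∈ S then 1 else 0 := by
          rw [Finset.sum_eq_single j]
          · rw [sub_self, if_pos rfl, hn1]
          · intro i _ hi
            rw [if_neg (sub_ne_zero.2 hi.symm), ite_self]
          · simp
  exact ⟨e, fun t ht => by rw [hev, if_pos ht], fun t ht => by rw [hev, if_neg ht]⟩

/-- For each reduction `ε`, `J` takes as many final positions as `S` has places over `ε`. -/
lemma exists_coord (hψ : ψ.IsPrimitive) (S : Finset (ZMod n × ZMod 2)) :
    ∃ J : Finset (ZMod n × ZMod 2), J.card = S.card ∧ ∀ x : CyclicRing n,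
      (∀ t ∉ S, evalHom ψ t x = 0) → (∀ j ∈ J, Z4v.reduction j.2 (x.coeff j.1) = 0) →
      ∀ t, evalHom ψ t x = 0 := by
  classical
  refine ⟨Finset.univ.filter fun j =>
    n - (Finset.univ.filter fun i => (i, j.2) ∈ S).card ≤ j.1.val, ?_, fun x hx hJ t => ?_⟩
  · have h1 : ∀ P : ZMod n × ZMod 2 → Prop, [DecidablePred P] → (Finset.univ.filter P).card =
        ∑ ε : ZMod 2, (Finset.univ.filter fun i => P (i, ε)).card := by
      intro P _
      simp only [Finset.card_filter, Fintype.sum_prod_type_right]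
    have h2 := h1 (· ∈ S)
    rw [Finset.filter_univ_mem] at h2
    rw [h1, h2]
    refine Finset.sum_congr rfl fun ε _ => ?_
    have hle : (Finset.univ.filter fun i : ZMod n => (i, ε) ∈ S).card ≤ n :=
      (Finset.card_le_univ _).trans (ZMod.card n).le
    have h3 := card_filter_le_val (n := n)
      (n - (Finset.univ.filter fun i : ZMod n => (i, ε) ∈ S).card)
    rwa [Nat.sub_sub_self hle] at h3
  · exact evalHom_eq_zero (reduction_eq_zero_of_evalHom hψ S t.2 x hx fun k hk =>
      hJ (k, t.2) (by simpa using hk))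

/-- The evaluations of the group ring at the `n`-th roots of unity and the two reductions. -/
noncomputable def evaluationFrame (hn : Odd n) (hψ : ψ.IsPrimitive) :
    EvaluationFrame (CyclicRing n) K (ZMod n × ZMod 2) where
  ev := evalHom ψ
  frob := frobPerm hn
  ev_frob := evalHom_frobPerm hn
  two_eq_zero := by exact_mod_cast CharP.cast_eq_zero K 2
  four_eq_zero := four_eq_zero
  dvd_of_ev := two_dvd_of_evalHom hψ
  dvd_of_two_mul := two_dvd_of_two_mul
  exists_indicator := exists_indicator hn hψ
  coord j :=
    { toFun x := Z4v.reduction j.2 (x.coeff j.1)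
      map_zero' := by simp
      map_add' x y := by simp }
  exists_coord := exists_coord hψ
  card_eq := card_eq

lemma evalHom_conj (t : ZMod n × ZMod 2) (x : CyclicRing n) :
    evalHom ψ t (conj x) = evalHom ψ (-t.1, t.2) x := by
  rw [evalHom_apply, evalHom_apply]
  refine Fintype.sum_equiv (Equiv.neg _) _ _ fun k => ?_
  rw [coeff_conj, Equiv.neg_apply, neg_mul_neg]

end CyclicRing

end Frame

/-! ### Places whose orbit is closed under inversion. -/

/-- A residue class is `2`-cyclotomically equivalent to its negative exactly when its order lies
in `N₂`. -/
lemma sameCycle_neg_iff {n : ℕ} [NeZero n] (hn : Odd n) (t : ZMod n × ZMod 2) :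
    (CyclicRing.frobPerm hn).SameCycle t (-t.1, t.2) ↔ addOrderOf t.1 ∈ N2 := by
  have hpow : ∀ k : ℕ, (CyclicRing.frobPerm hn ^ k) t = (2 ^ k * t.1, t.2) := by
    intro k
    induction k with
    | zero => simp
    | succ k ih => rw [pow_succ', Equiv.Perm.mul_apply, ih, CyclicRing.frobPerm_apply]; simp; ring
  have hord : ∀ k : ℕ, 2 ^ k * t.1 = -t.1 ↔ addOrderOf t.1 ∣ 2 ^ k + 1 := by
    intro k
    rw [addOrderOf_dvd_iff_nsmul_eq_zero, nsmul_eq_mul, eq_neg_iff_add_eq_zero]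
    push_cast
    rw [add_mul, one_mul]
  constructor
  · intro h
    -- This form gives a positive exponent, as `N2` demands, even when `t.1 = -t.1`.
    obtain ⟨k, hk, -, hkt⟩ := h.exists_pow_eq''
    rw [hpow, Prod.mk.injEq] at hkt
    exact ⟨addOrderOf_pos _, k, hk, (hord k).1 hkt.1⟩
  · rintro ⟨-, k, -, hk⟩
    exact ⟨k, by rw [zpow_natCast, hpow, (hord k).2 hk]⟩

-- There are `φ(j)` residues of each order `j ∣ n`; the factor 2 counts the reductions.
open Classical in
lemma card_sameCycle_neg {n : ℕ} [NeZero n] (hn : Odd n) :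
    (Finset.univ.filter fun t : ZMod n × ZMod 2 =>
      (CyclicRing.frobPerm hn).SameCycle t (-t.1, t.2)).card = 2 * B n := by
  have h1 : (Finset.univ.filter fun i : ZMod n => addOrderOf i ∈ N2).card = B n := by
    rw [B, Finset.card_eq_sum_card_fiberwise (f := addOrderOf)
      (t := n.divisors.filter (· ∈ N2))]
    · refine Finset.sum_congr rfl fun j hj => ?_
      rw [Finset.mem_filter, Nat.mem_divisors] at hj
      rw [← IsAddCyclic.card_addOrderOf_eq_totient (α := ZMod n) (d := j) (by simpa using hj.1.1)]
      congr 1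
      ext i
      simp only [Finset.mem_filter, Finset.mem_univ, true_and]
      exact ⟨fun h => h.2, fun h => ⟨h ▸ hj.2, h⟩⟩
    · intro i hi
      have hd : addOrderOf i ∣ n := by simpa using addOrderOf_dvd_card (x := i)
      simp only [Finset.coe_filter, Finset.mem_univ, true_and, Set.mem_ofPred_eq] at hi
      simpa [NeZero.ne n] using ⟨hd, hi⟩
  have h2 : (Finset.univ.filter fun t : ZMod n × ZMod 2 =>
      (CyclicRing.frobPerm hn).SameCycle t (-t.1, t.2)) =
      (Finset.univ.filter fun i : ZMod n => addOrderOf i ∈ N2) ×ˢ Finset.univ := by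
    ext t
    simp [sameCycle_neg_iff]
  rw [h2, Finset.card_product, h1, Finset.card_univ, ZMod.card, mul_comm]

/-! ### Cyclic codes as ideals, and their duals. -/

namespace CyclicRing

variable {n : ℕ}

lemma coeff_single_mul (m : ZMod n) (r : Z4v) (x : CyclicRing n) (k : ZMod n) :
    (AddMonoidAlgebra.single m r * x).coeff k = r * x.coeff (k - m) :=
  AddMonoidAlgebra.coeff_single_mul_eq_mul_coeff _ fun _ _ => by rw [eq_sub_iff_add_eq']

variable [NeZero n]

/-- The word of coefficients of an element of the group ring. -/
def word (x : CyclicRing n) : Fin n → Z4v := fun i => x.coeff (ZMod.finEquiv n i)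

lemma word_add (x y : CyclicRing n) : word (x + y) = word x + word y := rfl

lemma word_bijective : Function.Bijective (word (n := n)) := by
  constructor
  · intro x y h
    refine AddMonoidAlgebra.ext (Finsupp.ext fun k => ?_)
    simpa [word] using congrFun h ((ZMod.finEquiv n).symm k)
  · intro c
    obtain ⟨x, hx⟩ := exists_coeff_eq fun k => c ((ZMod.finEquiv n).symm k)
    exact ⟨x, funext fun i => by simp [word, hx]⟩

lemma word_single_zero_mul (r : Z4v) (x : CyclicRing n) :
    word (AddMonoidAlgebra.single 0 r * x) = r • word x := by
  funext i
  simp [word]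

lemma word_single_one_mul (x : CyclicRing n) :
    word (AddMonoidAlgebra.single 1 1 * x) = cyclicShift (word x) := by
  funext i
  have h : ZMod.finEquiv n ((finRotate n).symm i) = ZMod.finEquiv n i - 1 := by
    obtain ⟨j, rfl⟩ := (finRotate n).surjective i
    rw [Equiv.symm_apply_apply, eq_sub_iff_add_eq, ← map_one (ZMod.finEquiv n), ← map_add]
    rw [finRotate_apply]
  simp only [word, coeff_single_mul, one_mul, cyclicShift, h]

/-- Cyclic codes are ideals of the group ring. -/
def codeIdeal (C : CyclicCode Z4v n) : Ideal (CyclicRing n) where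
  carrier := {x | word x ∈ C.1}
  add_mem' ha hb := C.1.add_mem ha hb
  zero_mem' := C.1.zero_mem
  smul_mem' y x hx := by
    change word (y * x) ∈ C.1
    have hshift : ∀ k : ℕ, word (AddMonoidAlgebra.single 1 1 ^ k * x) ∈ C.1 := by
      intro k
      induction k with
      | zero => simpa using hx
      | succ k ih =>
        rw [pow_succ', mul_assoc, word_single_one_mul]
        exact C.2 _ ih
    induction y using AddMonoidAlgebra.induction_linear with
    | zero =>
      rw [zero_mul]
      exact C.1.zero_mem
    | add y z hy hz =>
      rw [add_mul, word_add]
      exact C.1.add_mem hy hz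
    | single m r =>
      have : (AddMonoidAlgebra.single m r : CyclicRing n) =
          AddMonoidAlgebra.single 0 r * AddMonoidAlgebra.single 1 1 ^ m.val := by
        rw [AddMonoidAlgebra.single_pow, AddMonoidAlgebra.single_mul_single]
        simp
      rw [this, mul_assoc, word_single_zero_mul]
      exact C.1.smul_mem _ (hshift _)

lemma mem_codeIdeal {C : CyclicCode Z4v n} {x : CyclicRing n} :
    x ∈ codeIdeal C ↔ word x ∈ C.1 := Iff.rfl

lemma codeIdeal_bijective : Function.Bijective (codeIdeal (n := n)) := by
  constructor
  · intro C D h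
    refine Subtype.ext (Submodule.ext fun c => ?_)
    obtain ⟨x, rfl⟩ := word_bijective.2 c
    rw [← mem_codeIdeal, ← mem_codeIdeal, h]
  · intro I
    let C : Submodule Z4v (Fin n → Z4v) :=
      { carrier := word '' I
        add_mem' := by
          rintro _ _ ⟨x, hx, rfl⟩ ⟨y, hy, rfl⟩
          exact ⟨x + y, I.add_mem hx hy, rfl⟩
        zero_mem' := ⟨0, I.zero_mem, rfl⟩
        smul_mem' := by
          rintro r _ ⟨x, hx, rfl⟩
          exact ⟨_, I.mul_mem_left _ hx, word_single_zero_mul r x⟩ }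
    refine ⟨⟨C, ?_⟩, ?_⟩
    · rintro _ ⟨x, hx, rfl⟩
      exact ⟨_, I.mul_mem_left _ hx, word_single_one_mul x⟩
    · ext x
      exact word_bijective.1.mem_set_image

lemma coeff_mul_conj (x y : CyclicRing n) (j : ZMod n) :
    (x * conj y).coeff j = ∑ i, x.coeff i * y.coeff (i - j) := by
  rw [AddMonoidAlgebra.coeff_mul_antidiag x (conj y) j (Finset.univ.image fun i => (i, j - i))]
  · rw [Finset.sum_image fun a _ b _ h => congrArg Prod.fst h]
    refine Finset.sum_congr rfl fun i _ => ?_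
    rw [coeff_conj, neg_sub]
  · rintro ⟨a, b⟩
    simp only [Finset.mem_image, Finset.mem_univ, true_and, Prod.mk.injEq, exists_eq_left]
    rw [sub_eq_iff_eq_add', eq_comm]

lemma sum_word_mul_word (x y : CyclicRing n) :
    ∑ i, word x i * word y i = (x * conj y).coeff 0 := by
  rw [coeff_mul_conj]
  simp only [sub_zero]
  exact (ZMod.finEquiv n).toEquiv.sum_comp fun i => x.coeff i * y.coeff i

/-- The coefficient of `x * conj y` at `j` is the inner product of `x` with a shift of `y`. Since
the code is cyclic, orthogonality to it makes every coefficient vanish, not only the one at 0. -/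
lemma mem_dualIdeal_iff (C : CyclicCode Z4v n) (x : CyclicRing n) :
    x ∈ EvaluationFrame.dualIdeal conj (codeIdeal C) ↔ word x ∈ dualCode C.1 := by
  constructor
  · intro h c hc
    obtain ⟨y, rfl⟩ := word_bijective.2 c
    rw [sum_word_mul_word, h y hc]
    rfl
  · intro h y hy
    refine AddMonoidAlgebra.ext (Finsupp.ext fun j => ?_)
    have := h _ ((codeIdeal C).mul_mem_left (AddMonoidAlgebra.single j 1) hy)
    rw [sum_word_mul_word, coeff_mul_conj] at this
    rw [coeff_mul_conj, AddMonoidAlgebra.coeff_zero, Finsupp.zero_apply, ← this]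
    refine Finset.sum_congr rfl fun i _ => ?_
    rw [coeff_single_mul, one_mul, sub_zero]

lemma card_hull (C : CyclicCode Z4v n) : Nat.card (hull C.1) =
    Nat.card ↥(codeIdeal C ⊓ EvaluationFrame.dualIdeal conj (codeIdeal C)) := by
  refine (Nat.card_congr ((Equiv.ofBijective word word_bijective).subtypeEquiv fun x => ?_)).symm
  rw [Submodule.mem_inf, mem_dualIdeal_iff, mem_codeIdeal]
  exact Submodule.mem_inf.symm

end CyclicRing

theorem theorem5p2 (n : ℕ) (hn : Odd n) :
    averageHullTwoDim Z4v n = 10 * (n : ℝ) / 9 - 4 * (B n : ℝ) / 9 := by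
  classical
  have : NeZero n := ⟨hn.pos.ne'⟩
  -- Since `n` is invertible in `𝔽₂`, the cyclotomic field contains a primitive `n`-th root of
  -- unity.
  have : NeZero (n : ZMod 2) := ⟨by
    rw [Ne, ZMod.natCast_eq_zero_iff]
    exact hn.not_two_dvd_nat⟩
  let K := CyclotomicField n (ZMod 2)
  have : FiniteDimensional (ZMod 2) K := IsCyclotomicExtension.finiteDimensional {n} (ZMod 2) K
  have : Finite K := Module.finite_of_finite (ZMod 2)
  have : CharP K 2 := charP_of_injective_algebraMap (algebraMap (ZMod 2) K).injective 2
  let E := CyclicRing.evaluationFrame hn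
    (AddChar.zmodChar_primitive_of_primitive_root n (IsCyclotomicExtension.zeta_spec n (ZMod 2) K))
  have : Fintype (Ideal (CyclicRing n)) := Fintype.ofFinite _
  let Φ := Equiv.ofBijective _ (CyclicRing.codeIdeal_bijective (n := n))
  have hsum : ∑ I : Ideal (CyclicRing n),
      Real.logb 2 (Nat.card ↥(I ⊓ EvaluationFrame.dualIdeal CyclicRing.conj I)) =
      (5 / 9 * Fintype.card (ZMod n × ZMod 2) - 2 / 9 * (2 * B n : ℕ)) *
        Fintype.card (Ideal (CyclicRing n)) := by
    rw [← card_sameCycle_neg hn]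
    convert! E.sum_logb_card_inf_dualIdeal CyclicRing.conj (fun t => (-t.1, t.2))
      CyclicRing.evalHom_conj
  rw [Fintype.card_prod, ZMod.card, ZMod.card] at hsum
  have hN : (Fintype.card (Ideal (CyclicRing n)) : ℝ) ≠ 0 := by
    exact_mod_cast Fintype.card_ne_zero
  have htwo : ∑ C : CyclicCode Z4v n, twoDim (hull C.1) = ∑ I : Ideal (CyclicRing n),
      Real.logb 2 (Nat.card ↥(I ⊓ EvaluationFrame.dualIdeal CyclicRing.conj I)) :=
    Fintype.sum_equiv Φ _ _ fun C => by rw [twoDim, CyclicRing.card_hull]; rfl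
  rw [averageHullTwoDim, htwo, hsum, Fintype.card_congr Φ, mul_div_assoc, div_self hN]
  push_cast
  ring
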